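/- Let $F$ be a field, $A=F[T]$, $K=F(T)$, and let $K_\infty=F((1/T))$ carry the absolute value $|x|=e^{\deg x}$ ($|0|=0$) and $K_\infty^n$ the maximum norm $\|\cdot\|$, where $n\ge 2$. Write $\mathbf x\cdot\mathbf y=\sum_i x_iy_i$. For $\mathbf u\in K_\infty^n$ with $\|\mathbf u\|=1$, let $\mathbf L_{\mathbf u}=(L_{\mathbf u,1},\dots,L_{\mathbf u,n})\colon[0,\infty)\to\mathbb R^n$, where $L_{\mathbf u,i}(q)$ is the minimum of all $t\ge 0$ for which the points $\mathbf x\in A^n$ with $\|\mathbf x\|\le e^t$ and $|\mathbf u\cdot\mathbf x|\le e^{t-q}$ span a subspace of $K^n$ of dimension at least $i$. An $n$-system is a map $\mathbf P=(P_1,\dots,P_n)\colon[0,\infty)\to\mathbb R^n$ such that, for each $q\ge0$: (S1) $0\le P_1(q)\le\dots\le P_n(q)$ and $P_1(q)+\dots+P_n(q)=q$; (S2) there are $\epsilon>0$ and $k,\ell\in\{1,\dots,n\}$ with $\mathbf P(t)=\mathbf P(q)+(t-q)\mathbf e_\ell$ for $\max\{0,q-\epsilon\}\le t\le q$ and $\mathbf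 P(t)=\mathbf P(q)+(t-q)\mathbf e_k$ for $q\le t\le q+\epsilon$, where $(\mathbf e_1,\dots,\mathbf e_n)$ is the canonical basis of $\mathbb R^n$; (S3) if $q>0$ and $k>\ell$ in (S2), then $P_\ell(q)=\dots=P_k(q)$. A tuple $\mathbf f=(f_1,\dots,f_n)\in F[[T]]^n$ is normal for $(\varrho_1,\dots,\varrho_n)\in\mathbb N^n\setminus\{0\}$ if every non-zero $\mathbf a\in A^n$ with $\deg a_i\le\varrho_i-1$ for $1\le i\le n$ and $\mathrm{ord}_0(\mathbf a\cdot\mathbf f)\ge\varrho_1+\dots+\varrho_n-1$ satisfies $\mathrm{ord}_0(\mathbf a\cdot\mathbf f)=\varrho_1+\dots+\varrho_n-1$. Here $\mathbb N=\{0,1,2,\dots\}$, $\deg 0=-\infty$ and $\mathrm{ord}_0(0)=\infty$. **Theorem.** Let $\mathbf f=(f_1(T),\dots,f_n(T))\in F[[T]]^n$ be normal for each diagonal tuple $(\varrho,\dots,\varrho)$ with $\varrho\ge1$. Then $\mathbf u=(f_1(1/T),\dots,f_n(1/T))\in K_\infty^n$ satisfies $\|\mathbf u\|=1$. Moreover $\mathbf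 L_{\mathbf u}$ is an $n$-system with $\mathbf L_{\mathbf u}(q)\in\mathbb N^n$ for each $q\in\mathbb N$, and, among the $n$-systems $\mathbf P$ with $\mathbf P(q)\in\mathbb N^n$ for each $q\in\mathbb N$, it is the unique one such that $$P_1(q)=\lfloor q/n\rfloor\quad\text{and}\quad P_n(q)=\lceil q/n\rceil\qquad\text{for each }q\in\mathbb N.$$ -/

import Mathlib

open scoped Polynomial NNReal

namespace ParamGeom

noncomputable section

/-- The field `K_∞ = F((1/T))`, realised as Laurent series over `F` in the variable `1/T`:
the coefficient of index `m` is the coefficient of `T^(-m)`. -/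
abbrev KInf (F : Type*) [Field F] : Type _ := LaurentSeries F

section Field

variable {F : Type*} [Field F]

/-- The absolute value of `F((1/T))`: `|x| = exp (deg x)`, where `deg x` is minus the order of `x`
in `1/T`, and `|0| = 0`. -/
def absInf (x : KInf F) : ℝ :=
  open Classical in if x = 0 then 0 else Real.exp (-(x.order : ℝ))

/-- The maximum norm on `K_∞^n`. -/
def normInf {n : ℕ} (x : Fin n → KInf F) : ℝ := ⨆ i, absInf (x i)

/-- The embedding of `A = F[T]` in `K_∞ = F((1/T))`: `T` is the inverse of the variable `1/T`. -/
def polyToKInf : F[X] →+* KInf F :=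
  Polynomial.eval₂RingHom HahnSeries.C (HahnSeries.single (-1 : ℤ) (1 : F))

/-- For `f` in `F[[T]]`, the element `f(1/T)` of `F[[1/T]] ⊆ F((1/T))`. -/
def evalInvT (f : PowerSeries F) : KInf F := HahnSeries.ofPowerSeries ℤ F f

/-- The points `x` of `A^n` with `‖x‖ ≤ e^t` and `|u ⬝ x| ≤ e^(t-q)`. -/
def solutions {n : ℕ} (u : Fin n → KInf F) (q t : ℝ) : Set (Fin n → F[X]) :=
  {x | normInf (fun i => polyToKInf (x i)) ≤ Real.exp t ∧
    absInf (∑ i, u i * polyToKInf (x i)) ≤ Real.exp (t - q)}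

/-- The subspace of `K^n`, with `K = F(T)`, spanned by a set of points of `A^n`. -/
def spanK {n : ℕ} (S : Set (Fin n → F[X])) : Submodule (RatFunc F) (Fin n → RatFunc F) :=
  Submodule.span (RatFunc F) ((fun x i => algebraMap F[X] (RatFunc F) (x i)) '' S)

/-- The `t ≥ 0` for which the solutions span a subspace of dimension at least `j`. -/
def admissible {n : ℕ} (u : Fin n → KInf F) (q : ℝ) (j : ℕ) : Set ℝ :=
  {t | 0 ≤ t ∧ j ≤ Module.finrank (RatFunc F) (spanK (solutions u q t))}

/-- The map `L_u : [0,∞) → ℝ^n`. Its component of index `i` (counted from `0`) is the smallest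
`t ≥ 0` for which the solutions span a subspace of dimension at least `i + 1`; that the infimum is a
minimum is `isLeast_mapL` below. -/
def mapL {n : ℕ} (u : Fin n → KInf F) (q : ℝ≥0) (i : Fin n) : ℝ :=
  sInf (admissible u q (i.val + 1))

/-- `f` in `F[[T]]^n` is normal for `ρ` in `ℕ^n \ {0}`: every non-zero `a` in `F[T]^n` such that
`deg (a i) ≤ ρ i - 1` for all `i` and `ord_0 (a ⬝ f) ≥ ∑ i, ρ i - 1`
has `ord_0 (a ⬝ f) = ∑ i, ρ i - 1`. -/
def IsNormal {n : ℕ} (f : Fin n → PowerSeries F) (ρ : Fin n → ℕ) : Prop :=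
  ∀ a : Fin n → F[X], a ≠ 0 →
    (∀ i, (a i).degree < (ρ i : WithBot ℕ)) →
    ((∑ i, ρ i : ℕ) : ℕ∞) ≤ (∑ i, (a i : PowerSeries F) * f i).order + 1 →
    (∑ i, (a i : PowerSeries F) * f i).order + 1 = ((∑ i, ρ i : ℕ) : ℕ∞)

end Field

/-- `n`-systems on `[0,∞)`. -/
structure IsNSystem {n : ℕ} (P : ℝ≥0 → Fin n → ℝ) : Prop where
  nonneg : ∀ q i, 0 ≤ P q i
  mono : ∀ q, Monotone (P q)
  sum_eq : ∀ q, ∑ i, P q i = q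
  slopes : ∀ q : ℝ≥0, ∃ ε : ℝ, 0 < ε ∧ ∃ k l : Fin n,
    (∀ t : ℝ≥0, (q : ℝ) - ε ≤ t → t ≤ q →
      P t = P q + ((t : ℝ) - q) • (Pi.single l (1 : ℝ) : Fin n → ℝ)) ∧
    (∀ t : ℝ≥0, q ≤ t → (t : ℝ) ≤ q + ε →
      P t = P q + ((t : ℝ) - q) • (Pi.single k (1 : ℝ) : Fin n → ℝ)) ∧
    (0 < q → l < k → ∀ j : Fin n, l ≤ j → j ≤ k → P q j = P q l)

/-- `P` maps `ℕ` to `ℕ^n`. -/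
def MapsNatToNat {n : ℕ} (P : ℝ≥0 → Fin n → ℝ) : Prop :=
  ∀ (q : ℕ) (i : Fin n), ∃ m : ℕ, P (q : ℝ≥0) i = m

/-- The first component of `P` is `⌊q/n⌋` and the last one is `⌈q/n⌉`, for each `q` in `ℕ`. -/
def IsExtremal {n : ℕ} (hn : 2 ≤ n) (P : ℝ≥0 → Fin n → ℝ) : Prop :=
  ∀ q : ℕ, P (q : ℝ≥0) ⟨0, by omega⟩ = (⌊(q : ℝ) / (n : ℝ)⌋ : ℝ) ∧
    P (q : ℝ≥0) ⟨n - 1, by omega⟩ = (⌈(q : ℝ) / (n : ℝ)⌉ : ℝ)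

section Minimum

variable {F : Type*} [Field F]

theorem absInf_le_exp_iff (x : KInf F) (s : ℝ) :
    absInf x ≤ Real.exp s ↔ x = 0 ∨ -x.order ≤ ⌊s⌋ := by
  unfold absInf
  split_ifs with h
  · simp [h, (Real.exp_pos s).le]
  · rw [Real.exp_le_exp, Int.le_floor]
    simp [h]

theorem absInf_nonneg (x : KInf F) : 0 ≤ absInf x := by
  unfold absInf
  split_ifs
  · exact le_rfl
  · exact (Real.exp_pos _).le

theorem normInf_le_iff {n : ℕ} (x : Fin n → KInf F) {c : ℝ} (hc : 0 ≤ c) :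
    normInf x ≤ c ↔ ∀ i, absInf (x i) ≤ c :=
  ⟨fun h i => (le_ciSup (Set.finite_range fun i => absInf (x i)).bddAbove i).trans h,
    fun h => Real.iSup_le h hc⟩

theorem solutions_congr {n : ℕ} (u : Fin n → KInf F) {q s t : ℝ} (h₁ : ⌊s⌋ = ⌊t⌋)
    (h₂ : ⌊s - q⌋ = ⌊t - q⌋) : solutions u q s = solutions u q t := by
  ext x
  simp only [solutions, Set.mem_ofPred_eq, normInf_le_iff _ (Real.exp_pos _).le,
    absInf_le_exp_iff, h₁, h₂]

theorem absInf_one : absInf (1 : KInf F) = 1 := by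
  simp [absInf]

theorem single_mem_solutions {n : ℕ} {u : Fin n → KInf F} (hu : normInf u = 1) (q : ℝ≥0)
    (i : Fin n) : (Pi.single i 1 : Fin n → F[X]) ∈ solutions u q q := by
  have h1 : ∀ j, polyToKInf ((Pi.single i 1 : Fin n → F[X]) j)
      = (Pi.single i 1 : Fin n → KInf F) j := by
    intro j
    by_cases h : j = i
    · subst h; simp
    · simp [h]
  refine ⟨(normInf_le_iff _ (Real.exp_pos _).le).2 fun j => ?_, ?_⟩
  · rw [h1]
    by_cases h : j = i
    · subst h; simp [absInf_one]
    · simp [h, absInf, Real.exp_nonneg]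
  · have h2 : ∑ j, u j * polyToKInf ((Pi.single i 1 : Fin n → F[X]) j) = u i := by
      rw [Finset.sum_congr rfl fun j _ => by rw [h1 j], Finset.sum_eq_single i]
      · simp
      · intro j _ h
        simp [h]
      · simp
    rw [h2, sub_self, Real.exp_zero]
    exact (normInf_le_iff u zero_le_one).1 hu.le i

theorem mem_admissible {n : ℕ} {u : Fin n → KInf F} (hu : normInf u = 1) (q : ℝ≥0)
    (i : Fin n) : (q : ℝ) ∈ admissible u q (i.val + 1) := by
  refine ⟨q.2, ?_⟩
  have : spanK (solutions u q q) = ⊤ := by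
    rw [eq_top_iff, ← (Pi.basisFun (RatFunc F) (Fin n)).span_eq]
    refine Submodule.span_mono ?_
    rintro _ ⟨j, rfl⟩
    refine ⟨_, single_mem_solutions hu q j, ?_⟩
    funext k
    by_cases h : k = j
    · subst h; simp
    · simp [h]
  rw [this, finrank_top, Module.finrank_fin_fun]
  omega

/-- For `u` of norm `1`, the infimum that defines `L_u` is a minimum. -/
theorem isLeast_mapL {n : ℕ} {u : Fin n → KInf F} (hu : normInf u = 1) (q : ℝ≥0) (i : Fin n) :
    IsLeast (admissible u q (i.val + 1)) (mapL u q i) := by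
  have hne : (admissible u q (i.val + 1)).Nonempty := ⟨_, mem_admissible hu q i⟩
  have hbd : BddBelow (admissible u q (i.val + 1)) := ⟨0, fun t ht => ht.1⟩
  refine ⟨?_, fun t ht => csInf_le hbd ht⟩
  have hlt : mapL u q i < min ((⌊mapL u q i⌋ : ℝ) + 1) (⌊mapL u q i - q⌋ + 1 + q) := by
    refine lt_min (Int.lt_floor_add_one _) ?_
    linarith [Int.lt_floor_add_one (mapL u q i - q)]
  obtain ⟨t, ht, hts⟩ := exists_lt_of_csInf_lt hne hlt
  have hst : mapL u q i ≤ t := csInf_le hbd ht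
  obtain ⟨hta, htb⟩ := lt_min_iff.1 hts
  have e₁ : ⌊t⌋ = ⌊mapL u q i⌋ :=
    Int.floor_eq_iff.2 ⟨(Int.floor_le _).trans hst, hta⟩
  have e₂ : ⌊t - q⌋ = ⌊mapL u q i - q⌋ :=
    Int.floor_eq_iff.2 ⟨(Int.floor_le _).trans (by linarith), by linarith⟩
  refine ⟨le_csInf hne fun s hs => hs.1, ?_⟩
  rw [← solutions_congr u e₁ e₂]
  exact ht.2

end Minimum

end

end ParamGeom

namespace ParamGeom

/-! ### Coefficients of Laurent series in `1/T` -/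

section Series

variable {F : Type*} [Field F]

/-! Write `u` for the point with coordinates `f i (1/T)`. Reversing coefficients turns a point `x`
with coordinates of degree at most `d` into a tuple `a` with `u ⬝ x = T^d (a ⬝ f)(1/T)`. Diagonal
normality then says that no non-zero `x` of degree less than `r` makes the coefficients of `u ⬝ x`
vanish at all indices below `n r - r + 1` (`IsNormal.boundedSolutions_eq_bot`).

Consider the points of degree at most `r` for which these coefficients vanish below `n r - r + k`,
where `k ≤ n`. Counting unknowns and equations gives `F`-dimension at least `n - k`; normality for
`r + 1` gives at most `n - k`. Normality for `r` makes `F`-independent points of such a space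
independent over `F[T]` (`linearIndependent_poly_of_boundedSolutions`), so the dimension over `K` is
known too. Hence `L_u` is the explicit map `regularSystem n` (`isLeast_regularSystem`), in which, on
each block `[n r, n (r + 1)]`, the coordinates rise from `r` to `r + 1` one at a time, the last one
first.

For uniqueness, the extremal condition leaves only two possible values for the coordinates at an
integer; their order and their sum decide which coordinate takes which. Between consecutive
integers, monotonicity freezes all coordinates but one, and the sum fixes that one. -/

theorem absInf_le_exp_iff_coeff (x : KInf F) (s : ℝ) :
    absInf x ≤ Real.exp s ↔ ∀ j : ℤ, (j : ℝ) < -s → x.coeff j = 0 := by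
  unfold absInf
  split_ifs with h
  · simp [h, (Real.exp_pos s).le]
  · rw [Real.exp_le_exp]
    constructor
    · intro hs j hj
      refine HahnSeries.coeff_eq_zero_of_lt_order ?_
      have : (j : ℝ) < (x.order : ℝ) := by linarith
      exact_mod_cast this
    · intro H
      by_contra! hs
      exact h (HahnSeries.coeff_order_eq_zero.1 (H x.order (by linarith)))

theorem coeff_mul_eq_zero_of_lt {a b : KInf F} {α β j : ℤ}
    (ha : ∀ i < α, a.coeff i = 0) (hb : ∀ i < β, b.coeff i = 0) (hj : j < α + β) :
    (a * b).coeff j = 0 := by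
  rw [HahnSeries.coeff_mul]
  refine Finset.sum_eq_zero fun p hp => ?_
  rw [Finset.mem_antidiagonal] at hp
  rcases lt_or_ge p.1 α with h | h
  · rw [ha _ h, zero_mul]
  · rw [hb p.2 (by omega), mul_zero]

theorem coeff_mul_add_of_forall_lt {a b : KInf F} {α β : ℤ}
    (ha : ∀ i < α, a.coeff i = 0) (hb : ∀ i < β, b.coeff i = 0) :
    (a * b).coeff (α + β) = a.coeff α * b.coeff β := by
  rw [HahnSeries.coeff_mul]
  rw [Finset.sum_eq_single (α, β)]
  · intro p hp hne
    rw [Finset.mem_antidiagonal] at hp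
    rcases lt_trichotomy p.1 α with h | h | h
    · rw [ha _ h, zero_mul]
    · exact absurd (Prod.ext h (by simp; omega)) hne
    · rw [hb p.2 (by omega), mul_zero]
  · intro h
    by_contra hne
    exact h (Finset.mem_antidiagonal.2
      ⟨fun h0 => hne (by rw [h0, zero_mul]), fun h0 => hne (by rw [h0, mul_zero]), rfl⟩)

theorem polyToKInf_monomial (k : ℕ) (a : F) :
    polyToKInf (Polynomial.monomial k a) = HahnSeries.single (-(k : ℤ)) a := by
  simp [polyToKInf, Polynomial.eval₂_monomial, HahnSeries.single_pow, HahnSeries.C_apply]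

theorem coeff_polyToKInf (x : F[X]) (j : ℤ) :
    (polyToKInf x).coeff j = if j ≤ 0 then x.coeff (-j).toNat else 0 := by
  induction x using Polynomial.induction_on' with
  | add p q hp hq =>
    rw [map_add, HahnSeries.coeff_add, hp, hq]
    split_ifs <;> simp
  | monomial k a =>
    rw [polyToKInf_monomial, HahnSeries.coeff_single, Polynomial.coeff_monomial]
    split_ifs <;> first | rfl | (exfalso; omega)

theorem coeff_polyToKInf_neg (x : F[X]) (k : ℕ) :
    (polyToKInf x).coeff (-(k : ℤ)) = x.coeff k := by
  simp [coeff_polyToKInf]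

theorem coeff_polyToKInf_of_degree_lt {x : F[X]} {d : ℕ} (hx : x ∈ Polynomial.degreeLT F d)
    {j : ℤ} (hj : j ≤ -(d : ℤ)) : (polyToKInf x).coeff j = 0 := by
  rw [coeff_polyToKInf, if_pos (by omega)]
  rw [Polynomial.mem_degreeLT, Polynomial.degree_lt_iff_coeff_zero] at hx
  exact hx _ (by omega)

theorem natDegree_le_of_mem_degreeLT_succ {x : F[X]} {d : ℕ}
    (hx : x ∈ Polynomial.degreeLT F (d + 1)) : x.natDegree ≤ d := by
  rw [Polynomial.mem_degreeLT, Polynomial.degree_lt_iff_coeff_zero] at hx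
  exact Polynomial.natDegree_le_iff_coeff_eq_zero.2 fun k hk => hx k hk

theorem coeff_evalInvT_of_neg (f : PowerSeries F) {j : ℤ} (hj : j < 0) :
    (evalInvT f).coeff j = 0 := by
  rw [evalInvT, HahnSeries.ofPowerSeries_apply]
  refine HahnSeries.embDomain_of_notMem_range ?_
  rintro ⟨k, hk⟩
  simp at hk
  omega

theorem coeff_evalInvT (f : PowerSeries F) (k : ℕ) :
    (evalInvT f).coeff (k : ℤ) = PowerSeries.coeff k f :=
  HahnSeries.ofPowerSeries_apply_coeff f k

/-- This is `x(T) = T^d x*(1/T)` with `x*` the reversed polynomial; it carries conditions at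
infinity to conditions at `0`, where normality is stated. -/
theorem polyToKInf_eq_single_mul_reflect {x : F[X]} {d : ℕ}
    (hx : x ∈ Polynomial.degreeLT F (d + 1)) :
    polyToKInf x = HahnSeries.single (-(d : ℤ)) (1 : F) *
      evalInvT ((x.reflect d : F[X]) : PowerSeries F) := by
  ext j
  have h : j = (j + d) + -(d : ℤ) := by ring
  rcases lt_or_ge (j + d) 0 with hj | hj
  · rw [coeff_polyToKInf_of_degree_lt hx (by push_cast; omega), h,
      HahnSeries.coeff_single_mul_add, coeff_evalInvT_of_neg _ hj, mul_zero]
  · obtain ⟨k, hk⟩ := Int.eq_ofNat_of_zero_le hj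
    conv_rhs => rw [h, HahnSeries.coeff_single_mul_add, hk, coeff_evalInvT, one_mul]
    rw [Polynomial.coeff_coe, Polynomial.coeff_reflect, coeff_polyToKInf]
    split_ifs with h0
    · rw [Polynomial.revAt_le (by omega)]
      congr 1
      omega
    -- Above index `d`, `reflect d` leaves coefficients in place, and there they vanish by the
    -- degree bound.
    · rw [Polynomial.mem_degreeLT, Polynomial.degree_lt_iff_coeff_zero] at hx
      rw [Polynomial.revAt_eq_self_of_lt (by omega), hx _ (by omega)]

end Series

/-! ### Solution spaces over `F`, and their spans over `K` -/

section Solutions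

variable {F : Type*} [Field F] {n : ℕ}

/-- The `F`-linear form `x ↦ u ⬝ x` on `F[T]^n`. -/
noncomputable def dotForm (u : Fin n → KInf F) : (Fin n → F[X]) →ₗ[F] KInf F where
  toFun x := ∑ i, u i * polyToKInf (x i)
  map_add' x y := by simp [mul_add, Finset.sum_add_distrib]
  map_smul' c x := by
    have h (p : F[X]) : polyToKInf (c • p) = c • polyToKInf p := by
      rw [Polynomial.smul_eq_C_mul, map_mul, ← HahnSeries.C_mul_eq_smul]
      simp [polyToKInf]
    simp only [Pi.smul_apply, h, ← HahnSeries.C_mul_eq_smul, Finset.mul_sum, RingHom.id_apply]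
    exact Finset.sum_congr rfl fun i _ => by ring

theorem dotForm_apply (u : Fin n → KInf F) (x : Fin n → F[X]) :
    dotForm u x = ∑ i, u i * polyToKInf (x i) := rfl

theorem dotForm_poly_smul (u : Fin n → KInf F) (c : F[X]) (x : Fin n → F[X]) :
    dotForm u (c • x) = polyToKInf c * dotForm u x := by
  simp only [dotForm_apply, Pi.smul_apply, smul_eq_mul, map_mul, Finset.mul_sum]
  exact Finset.sum_congr rfl fun i _ => by ring

/-- The points `x` of `F[T]^n` with coordinates of degree less than `d`, such that the coefficients
of `u ⬝ x` of index less than `e` vanish. -/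
noncomputable def boundedSolutions (u : Fin n → KInf F) (d : ℕ) (e : ℤ) :
    Submodule F (Fin n → F[X]) where
  carrier := {x | (∀ i, x i ∈ Polynomial.degreeLT F d) ∧ ∀ j < e, (dotForm u x).coeff j = 0}
  zero_mem' := ⟨fun i => zero_mem _, fun j _ => by simp⟩
  add_mem' := fun hx hy => ⟨fun i => add_mem (hx.1 i) (hy.1 i), fun j hj => by
    rw [map_add, HahnSeries.coeff_add, hx.2 j hj, hy.2 j hj, add_zero]⟩
  smul_mem' := fun c x hx => ⟨fun i => Submodule.smul_mem _ c (hx.1 i), fun j hj => by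
    rw [map_smul, HahnSeries.coeff_smul, hx.2 j hj, smul_zero]⟩

theorem mem_solutions_iff {u : Fin n → KInf F} {q t : ℝ} {x : Fin n → F[X]} :
    x ∈ solutions u q t ↔ (∀ i, ∀ j : ℤ, (j : ℝ) < -t → (polyToKInf (x i)).coeff j = 0) ∧
      ∀ j : ℤ, (j : ℝ) < q - t → (dotForm u x).coeff j = 0 := by
  simp only [solutions, Set.mem_ofPred_eq, normInf_le_iff _ (Real.exp_pos _).le,
    absInf_le_exp_iff_coeff, dotForm_apply, neg_sub]

/-- With the next inclusion, this replaces the real parameters `q`, `t` by integral ones: degrees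
and indices are integers, so the bounds may be rounded by less than `1`. -/
theorem boundedSolutions_subset_solutions {u : Fin n → KInf F} {d : ℕ} {e : ℤ} {q t : ℝ}
    (hd : (d : ℝ) ≤ t + 1) (he : q - t ≤ e) :
    (boundedSolutions u d e : Set (Fin n → F[X])) ⊆ solutions u q t := by
  intro x hx
  refine mem_solutions_iff.2 ⟨fun i j hj => coeff_polyToKInf_of_degree_lt (hx.1 i) ?_,
    fun j hj => hx.2 j ?_⟩
  · have : (j : ℝ) < ((1 - d : ℤ) : ℝ) := by push_cast; linarith
    have := Int.cast_lt.1 this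
    omega
  · exact_mod_cast hj.trans_le he

theorem solutions_subset_boundedSolutions {u : Fin n → KInf F} {d : ℕ} {e : ℤ} {q t : ℝ}
    (hd : t < d) (he : (e : ℝ) < q - t + 1) :
    solutions u q t ⊆ (boundedSolutions u d e : Set (Fin n → F[X])) := by
  intro x hx
  rw [mem_solutions_iff] at hx
  refine ⟨fun i => ?_, fun j hj => hx.2 j ?_⟩
  · rw [Polynomial.mem_degreeLT, Polynomial.degree_lt_iff_coeff_zero]
    intro k hk
    rw [← coeff_polyToKInf_neg]
    refine hx.1 i _ ?_
    have : (d : ℝ) ≤ k := by exact_mod_cast hk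
    push_cast
    linarith
  · have : ((j + 1 : ℤ) : ℝ) ≤ (e : ℝ) := by exact_mod_cast hj
    push_cast at this
    linarith

theorem coeff_dotForm_eq_zero_of_degree_lt (f : Fin n → PowerSeries F) {d : ℕ}
    {x : Fin n → F[X]} (hx : ∀ i, x i ∈ Polynomial.degreeLT F d) {j : ℤ}
    (hj : j ≤ -(d : ℤ)) : (dotForm (fun i => evalInvT (f i)) x).coeff j = 0 := by
  rw [dotForm_apply, HahnSeries.coeff_sum]
  refine Finset.sum_eq_zero fun i _ => ?_
  exact coeff_mul_eq_zero_of_lt (α := 0) (β := 1 - d) (fun k hk => coeff_evalInvT_of_neg _ hk)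
    (fun k hk => coeff_polyToKInf_of_degree_lt (hx i) (by omega)) (by omega)

theorem dotForm_eq_single_mul (f : Fin n → PowerSeries F) {d : ℕ} {x : Fin n → F[X]}
    (hx : ∀ i, x i ∈ Polynomial.degreeLT F (d + 1)) :
    dotForm (fun i => evalInvT (f i)) x = HahnSeries.single (-(d : ℤ)) (1 : F) *
      evalInvT (∑ i, ((x i).reflect d : PowerSeries F) * f i) := by
  rw [dotForm_apply, evalInvT, map_sum, Finset.mul_sum]
  refine Finset.sum_congr rfl fun i _ => ?_
  rw [polyToKInf_eq_single_mul_reflect (hx i), map_mul]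
  simp only [evalInvT]
  ring

/-- For `r = d + 1`, the threshold `n r - r + 1 = n r - d` amounts to order at least `n r` for the
reversed combination, one more than the value `n r - 1` that normality imposes. -/
theorem IsNormal.boundedSolutions_eq_bot {f : Fin n → PowerSeries F}
    (hf : ∀ r : ℕ, 1 ≤ r → IsNormal f (fun _ => r)) (r : ℕ) :
    boundedSolutions (fun i => evalInvT (f i)) r (n * r - r + 1) = ⊥ := by
  rw [Submodule.eq_bot_iff]
  rintro x ⟨hx, hux⟩
  rcases r with _ | d
  · funext i
    simpa [Polynomial.mem_degreeLT] using hx i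
  by_contra hne
  have ha : (fun i => (x i).reflect d) ≠ 0 := by
    intro h
    refine hne (funext fun i => ?_)
    have := congrFun h i
    simpa using this
  have hord : ((n * (d + 1) : ℕ) : ℕ∞) ≤
      (∑ i, ((x i).reflect d : PowerSeries F) * f i).order := by
    refine PowerSeries.le_order _ _ fun k hk => ?_
    have hk : k < n * (d + 1) := by exact_mod_cast hk
    have hk' : (k : ℤ) < n * (d + 1) := by exact_mod_cast hk
    have h := hux ((k : ℤ) + -(d : ℤ)) (by push_cast; linarith)
    rwa [dotForm_eq_single_mul f hx, HahnSeries.coeff_single_mul_add, one_mul,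
      coeff_evalInvT] at h
  have h := hf (d + 1) (by omega) _ ha (fun i => by
    have hi := hx i
    rw [Polynomial.mem_degreeLT, Polynomial.degree_lt_iff_coeff_zero] at hi
    rw [Polynomial.degree_lt_iff_coeff_zero]
    intro k hk
    have hk : d + 1 ≤ k := hk
    rw [Polynomial.coeff_reflect, Polynomial.revAt_eq_self_of_lt (by omega), hi _ hk])
    (by simpa using hord.trans le_self_add)
  rw [Finset.sum_const, Finset.card_univ, Fintype.card_fin, smul_eq_mul] at h
  have h1 := h ▸ add_le_add_left hord 1
  have : n * (d + 1) + 1 ≤ n * (d + 1) := by exact_mod_cast h1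
  omega

/-- There are `n d` unknown coefficients and `N` equations, at the indices from `1 - d` to `N - d`:
below these, the coefficients vanish by the degree bound alone. -/
theorem exists_linearIndependent_boundedSolutions (f : Fin n → PowerSeries F) {d N p : ℕ}
    (h : p + N ≤ n * d) :
    ∃ x : Fin p → Fin n → F[X], LinearIndependent F x ∧
      ∀ i, x i ∈ boundedSolutions (fun i => evalInvT (f i)) d (N - d + 1) := by
  let Ψ : (Fin n → Fin d → F) →ₗ[F] (Fin n → F[X]) :=
    LinearMap.pi fun i => (Polynomial.degreeLT F d).subtype ∘ₗ
      (Polynomial.degreeLTEquiv F d).symm.toLinearMap ∘ₗ LinearMap.proj i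
  have hΨmem (v i) : Ψ v i ∈ Polynomial.degreeLT F d :=
    ((Polynomial.degreeLTEquiv F d).symm (v i)).2
  have hΨ : LinearMap.ker Ψ = ⊥ := by
    rw [LinearMap.ker_eq_bot']
    intro v hv
    funext i
    have := congrFun hv i
    have h2 : (Polynomial.degreeLTEquiv F d).symm (v i) = 0 := Subtype.ext this
    simpa using h2
  let Φ : (Fin n → Fin d → F) →ₗ[F] (Fin N → F) :=
    { toFun := fun v j => (dotForm (fun i => evalInvT (f i)) (Ψ v)).coeff ((j : ℤ) - d + 1)
      map_add' := fun v w => by funext j; simp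
      map_smul' := fun c v => by funext j; simp }
  have hrank := Φ.finrank_range_add_finrank_ker
  have hrange : Module.finrank F (LinearMap.range Φ) ≤ N := by
    simpa using Submodule.finrank_le (LinearMap.range Φ)
  have hdom : Module.finrank F (Fin n → Fin d → F) = n * d := by
    simp [Module.finrank_pi_fintype]
  obtain ⟨b, hb⟩ := exists_linearIndependent_of_le_finrank
    (R := F) (M := LinearMap.ker Φ) (n := p) (by omega)
  refine ⟨fun i => Ψ (b i), ?_, fun i => ⟨hΨmem _, fun j hj => ?_⟩⟩
  · have h1 := hb.map' (LinearMap.ker Φ).subtype (Submodule.ker_subtype _)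
    exact h1.map' Ψ hΨ
  · rcases le_or_gt j (-(d : ℤ)) with hjd | hjd
    · exact coeff_dotForm_eq_zero_of_degree_lt f (hΨmem _) hjd
    · have h2 := congrFun (LinearMap.mem_ker.1 (b i).2) ⟨(j + d - 1).toNat, by omega⟩
      have h3 : (((j + d - 1).toNat : ℕ) : ℤ) - d + 1 = j := by omega
      change (dotForm _ _).coeff (((j + d - 1).toNat : ℕ) - (d : ℤ) + 1) = 0 at h2
      rwa [h3] at h2

/-- If the next `n - k` coefficients vanish as well, the threshold reaches `n r - r + n = n (r + 1)
- (r + 1) + 1`, where only `0` remains. -/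
theorem finrank_boundedSolutions_le {f : Fin n → PowerSeries F}
    (hf : ∀ r : ℕ, 1 ≤ r → IsNormal f (fun _ => r)) (r : ℕ) {k : ℕ} (hk : k ≤ n) :
    Module.Finite F (boundedSolutions (fun i => evalInvT (f i)) (r + 1) (n * r - r + k)) ∧
    Module.finrank F (boundedSolutions (fun i => evalInvT (f i)) (r + 1) (n * r - r + k))
      ≤ n - k := by
  set S := boundedSolutions (fun i => evalInvT (f i)) (r + 1) (n * r - r + k)
  let Φ : S →ₗ[F] (Fin (n - k) → F) :=
    { toFun := fun x j => (dotForm (fun i => evalInvT (f i)) x.1).coeff (n * r - r + k + j)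
      map_add' := fun v w => by funext j; simp
      map_smul' := fun c v => by funext j; simp }
  have hΦ : LinearMap.ker Φ = ⊥ := by
    rw [LinearMap.ker_eq_bot']
    intro x hx
    have hmem : x.1 ∈ boundedSolutions (fun i => evalInvT (f i)) (r + 1)
        (n * (r + 1 : ℕ) - (r + 1 : ℕ) + 1) := by
      refine ⟨x.2.1, fun j hj => ?_⟩
      rcases lt_or_ge j (n * r - r + k) with h | h
      · exact x.2.2 j h
      · push_cast at hj
        obtain ⟨l, hl : j - (n * r - r + k) = (l : ℤ)⟩ := Int.eq_ofNat_of_zero_le (sub_nonneg.2 h)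
        have hl' : (l : ℤ) < n - k := by rw [← hl]; linarith
        have h2 := congrFun hx ⟨l, by omega⟩
        have h3 : (n * r - r + k : ℤ) + l = j := by rw [← hl]; ring
        simpa [Φ, h3] using h2
    rw [IsNormal.boundedSolutions_eq_bot hf, Submodule.mem_bot] at hmem
    exact Subtype.ext hmem
  have hinj := LinearMap.ker_eq_bot.1 hΦ
  exact ⟨Module.Finite.of_injective Φ hinj, by
    simpa using LinearMap.finrank_le_finrank_of_injective hinj⟩

/-- The extreme terms of a relation over `F[T]` form a combination over `F` that gains one degree
and one vanishing index. By normality it is zero, so the leading coefficients of the relation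
vanish, and the degree descends. -/
theorem linearIndependent_poly_of_boundedSolutions {f : Fin n → PowerSeries F}
    (hf : ∀ r : ℕ, 1 ≤ r → IsNormal f (fun _ => r)) (r : ℕ) {ι : Type*} [Fintype ι]
    {x : ι → Fin n → F[X]} (hx : LinearIndependent F x)
    (hmem : ∀ i, x i ∈ boundedSolutions (fun i => evalInvT (f i)) (r + 1) (n * r - r)) :
    LinearIndependent F[X] x := by
  rw [Fintype.linearIndependent_iff] at hx ⊢
  intro c hc
  have key : ∀ D : ℕ, (∀ i, c i ∈ Polynomial.degreeLT F D) → c = 0 := by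
    intro D
    induction D with
    | zero =>
      intro h
      funext i
      simpa [Polynomial.mem_degreeLT] using h i
    | succ D ih =>
      intro h
      refine ih fun i => ?_
      -- The coefficient of `T^(D + r)` in the relation shows that the degree drops below `r`; the
      -- coefficient of index `-D + (n r - r)` in its product with `u` gives the extra vanishing.
      have hy : ∑ i, (c i).coeff D • x i ∈
          boundedSolutions (fun i => evalInvT (f i)) r (n * r - r + 1) := by
        have hS := Submodule.sum_mem _ fun i (_ : i ∈ Finset.univ) =>
          Submodule.smul_mem _ ((c i).coeff D) (hmem i)
        refine ⟨fun l => ?_, fun j hj => ?_⟩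
        · have hl := hS.1 l
          rw [Polynomial.mem_degreeLT, Polynomial.degree_lt_iff_coeff_zero] at hl ⊢
          intro k hk
          rcases hk.eq_or_lt with rfl | hk
          · have h1 := congrArg (fun p => Polynomial.coeff p (D + r)) (congrFun hc l)
            simp only [Finset.sum_apply, Pi.smul_apply, smul_eq_mul, Polynomial.finsetSum_coeff,
              Pi.zero_apply, Polynomial.coeff_zero] at h1
            simp only [Finset.sum_apply, Pi.smul_apply, Polynomial.finsetSum_coeff,
              Polynomial.coeff_smul, smul_eq_mul]
            rw [← h1]
            refine Finset.sum_congr rfl fun m _ => ?_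
            rw [Polynomial.coeff_mul_add_eq_of_natDegree_le]
            · exact natDegree_le_of_mem_degreeLT_succ (h m)
            · exact natDegree_le_of_mem_degreeLT_succ ((hmem m).1 l)
          · exact hl k hk
        · rcases (Int.lt_add_one_iff.1 hj).eq_or_lt with rfl | hj
          · have h1 := congrArg (fun y => (dotForm (fun i => evalInvT (f i)) y).coeff
              (-(D : ℤ) + (n * r - r))) hc
            simp only [map_sum, dotForm_poly_smul, HahnSeries.coeff_sum, map_zero,
              HahnSeries.coeff_zero] at h1
            simp only [map_sum, map_smul, HahnSeries.coeff_sum, HahnSeries.coeff_smul,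
              smul_eq_mul]
            rw [← h1]
            refine Finset.sum_congr rfl fun m _ => ?_
            rw [coeff_mul_add_of_forall_lt (α := -(D : ℤ)) (β := n * r - r) _ (hmem m).2,
              coeff_polyToKInf_neg]
            exact fun k hk => coeff_polyToKInf_of_degree_lt (h m) (by push_cast; omega)
          · exact hS.2 j hj
      rw [IsNormal.boundedSolutions_eq_bot hf, Submodule.mem_bot] at hy
      have h0 := hx _ hy i
      have hi := h i
      rw [Polynomial.mem_degreeLT, Polynomial.degree_lt_iff_coeff_zero] at hi ⊢
      intro k hk
      rcases hk.eq_or_lt with rfl | hk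
      · exact h0
      · exact hi k hk
  have h0 := key (Finset.univ.sup (fun i => (c i).natDegree) + 1) fun i => by
    rw [Polynomial.mem_degreeLT]
    refine Polynomial.degree_le_natDegree.trans_lt ?_
    have := Finset.le_sup (f := fun i => (c i).natDegree) (Finset.mem_univ i)
    exact_mod_cast Nat.lt_succ_of_le this
  exact fun i => congrFun h0 i

theorem card_le_finrank_spanK {ι : Type*} [Fintype ι] {S : Set (Fin n → F[X])}
    {x : ι → Fin n → F[X]} (hx : LinearIndependent F[X] x) (hS : ∀ i, x i ∈ S) :
    Fintype.card ι ≤ Module.finrank (RatFunc F) (spanK S) := by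
  have h1 : LinearIndependent F[X]
      ((Algebra.linearMap F[X] (RatFunc F)).compLeft (Fin n) ∘ x) := by
    refine hx.map' _ (LinearMap.ker_eq_bot.2 fun a b hab => ?_)
    funext i
    exact IsFractionRing.injective F[X] (RatFunc F) (congrFun hab i)
  rw [LinearIndependent.iff_fractionRing F[X] (RatFunc F)] at h1
  rw [← finrank_span_eq_card h1]
  refine Submodule.finrank_mono (Submodule.span_mono ?_)
  rintro _ ⟨i, rfl⟩
  exact ⟨x i, hS i, rfl⟩

theorem finrank_spanK_le (S : Submodule F (Fin n → F[X])) [Module.Finite F S] :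
    Module.finrank (RatFunc F) (spanK (S : Set (Fin n → F[X]))) ≤ Module.finrank F S := by
  let b := Module.finBasis F S
  let φ := (Algebra.linearMap F[X] (RatFunc F)).compLeft (Fin n)
  have hle : spanK (S : Set (Fin n → F[X])) ≤
      Submodule.span (RatFunc F) (Set.range fun i => φ (b i)) := by
    refine Submodule.span_le.2 ?_
    rintro _ ⟨x, hx, rfl⟩
    have h1 : x = ∑ i, Polynomial.C (b.repr ⟨x, hx⟩ i) • (b i : Fin n → F[X]) := by
      have := congrArg Subtype.val (b.sum_repr ⟨x, hx⟩)
      refine this.symm.trans ?_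
      rw [Submodule.coe_sum]
      refine Finset.sum_congr rfl fun i _ => ?_
      funext l
      simp [Polynomial.smul_eq_C_mul]
    change φ x ∈ _
    rw [h1, map_sum]
    refine Submodule.sum_mem _ fun i _ => ?_
    rw [map_smul, ← algebraMap_smul (RatFunc F)]
    exact Submodule.smul_mem _ _ (Submodule.subset_span ⟨i, rfl⟩)
  refine (Submodule.finrank_mono hle).trans ((finrank_range_le_card _).trans ?_)
  simp

theorem finrank_spanK_mono {S S' : Set (Fin n → F[X])} (h : S ⊆ S') :
    Module.finrank (RatFunc F) (spanK S) ≤ Module.finrank (RatFunc F) (spanK S') :=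
  Submodule.finrank_mono (Submodule.span_mono (Set.image_mono h))

theorem normInf_evalInvT_eq_one {f : Fin n → PowerSeries F} (hn : n ≠ 0)
    (hf : ∀ r : ℕ, 1 ≤ r → IsNormal f (fun _ => r)) :
    normInf (fun i => evalInvT (f i)) = 1 := by
  have hle (i) : absInf (evalInvT (f i)) ≤ 1 := by
    rw [← Real.exp_zero, absInf_le_exp_iff_coeff]
    intro j hj
    exact coeff_evalInvT_of_neg _ (by simpa using hj)
  obtain ⟨i, hi⟩ : ∃ i, PowerSeries.coeff 0 (f i) ≠ 0 := by
    by_contra! H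
    -- If all constant terms vanish, only the coefficients of index `1` to `n - 1` remain to be
    -- killed for order at least `n`: `n - 1` equations in `n` constants, against normality for `r =
    -- 1`.
    let Φ : (Fin n → F) →ₗ[F] (Fin (n - 1) → F) :=
      { toFun := fun a j => PowerSeries.coeff (j + 1) (∑ i, a i • f i)
        map_add' := fun v w => by funext j; simp [add_mul, Finset.sum_add_distrib]
        map_smul' := fun c v => by funext j; simp [Finset.mul_sum, mul_assoc] }
    obtain ⟨a, ha, ha0⟩ := Submodule.exists_mem_ne_zero_of_ne_bot
      (LinearMap.ker_ne_bot_of_finrank_lt (f := Φ) (by simp; omega))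
    have hmem : (fun i => Polynomial.C (a i)) ∈
        boundedSolutions (fun i => evalInvT (f i)) 1 (n * (1 : ℕ) - (1 : ℕ) + 1) := by
      have hd : ∀ i, Polynomial.C (a i) ∈ Polynomial.degreeLT F 1 := fun i => by
        rw [Polynomial.mem_degreeLT]
        exact Polynomial.degree_C_le.trans_lt (by simp)
      refine ⟨hd, fun j hj => ?_⟩
      rcases lt_or_ge j 0 with h | h
      · exact coeff_dotForm_eq_zero_of_degree_lt f hd (by push_cast; omega)
      · obtain ⟨k, rfl⟩ := Int.eq_ofNat_of_zero_le h
        have e : dotForm (fun i => evalInvT (f i)) (fun i => Polynomial.C (a i)) =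
            evalInvT (∑ i, a i • f i) := by
          rw [dotForm_apply, evalInvT, map_sum]
          refine Finset.sum_congr rfl fun i _ => ?_
          rw [PowerSeries.smul_eq_C_mul, map_mul, HahnSeries.ofPowerSeries_C, mul_comm, evalInvT]
          simp [polyToKInf]
        rw [e, coeff_evalInvT]
        rcases k with _ | k
        · simp [H]
        · push_cast at hj
          have := congrFun (LinearMap.mem_ker.1 ha) ⟨k, by omega⟩
          simpa [Φ] using this
    rw [IsNormal.boundedSolutions_eq_bot hf, Submodule.mem_bot] at hmem
    exact ha0 (funext fun i => by simpa using congrFun hmem i)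
  refine le_antisymm ((normInf_le_iff _ zero_le_one).2 hle) ?_
  refine le_trans ?_ ((normInf_le_iff _ (Real.iSup_nonneg fun i => absInf_nonneg _)).1 le_rfl i)
  have h0 : (evalInvT (f i)).coeff 0 ≠ 0 := by
    rw [← Nat.cast_zero, coeff_evalInvT]; exact hi
  have hne : evalInvT (f i) ≠ 0 := fun h => h0 (by rw [h, HahnSeries.coeff_zero])
  rw [absInf, if_neg hne]
  refine Real.one_le_exp ?_
  have := HahnSeries.order_le_of_coeff_ne_zero h0
  simpa using this

end Solutions

/-! ### The explicit system and its identification with `L_u` -/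

section RegularSystem

variable {n : ℕ}

/-- The `n`-system whose value at `n * r + j`, for `0 ≤ j ≤ n`, has its first `n - j` coordinates
equal to `r` and the others equal to `r + 1`, and which is affine between consecutive integers. -/
noncomputable def regularSystem (n : ℕ) (q : ℝ≥0) (i : Fin n) : ℝ :=
  (⌊(q : ℝ) / n⌋₊ : ℝ) + max 0 (min 1 ((q : ℝ) - n * (⌊(q : ℝ) / n⌋₊ : ℝ) - ((i.rev : ℕ) : ℝ)))

/-- The right end of the block is allowed: there the formulas of both adjacent blocks give `r + 1`.
-/
theorem regularSystem_eq (hn : n ≠ 0) {q : ℝ≥0} {r : ℕ} (h₁ : (n * r : ℝ) ≤ q)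
    (h₂ : (q : ℝ) ≤ n * (r + 1)) (i : Fin n) :
    regularSystem n q i = r + max 0 (min 1 ((q : ℝ) - n * r - ((i.rev : ℕ) : ℝ))) := by
  have hn' : (0 : ℝ) < n := by positivity
  have hi : ((i.rev : ℕ) : ℝ) + 1 ≤ n := by exact_mod_cast i.rev.2
  have hi0 : (0 : ℝ) ≤ ((i.rev : ℕ) : ℝ) := by positivity
  rcases h₂.eq_or_lt with h | h
  · have hr : ⌊(q : ℝ) / n⌋₊ = r + 1 := by
      rw [h, mul_div_cancel_left₀ _ hn'.ne']
      exact_mod_cast Nat.floor_natCast (R := ℝ) (r + 1)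
    rw [regularSystem, hr, h]
    push_cast
    rw [min_eq_right (by linarith), max_eq_left (by linarith), min_eq_left (by linarith),
      max_eq_right zero_le_one]
    ring
  · have hr : ⌊(q : ℝ) / n⌋₊ = r := by
      rw [Nat.floor_eq_iff (by positivity), le_div_iff₀ hn', div_lt_iff₀ hn']
      constructor <;> linarith
    rw [regularSystem, hr]

theorem exists_block (hn : n ≠ 0) (q : ℝ≥0) :
    ∃ r : ℕ, (n * r : ℝ) ≤ q ∧ (q : ℝ) < n * (r + 1) := by
  have hn' : (0 : ℝ) < n := by positivity
  refine ⟨⌊(q : ℝ) / n⌋₊, ?_, ?_⟩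
  · have := Nat.floor_le (a := (q : ℝ) / n) (by positivity)
    rwa [le_div_iff₀ hn', mul_comm] at this
  · have := Nat.lt_floor_add_one ((q : ℝ) / n)
    rwa [div_lt_iff₀ hn', mul_comm] at this

theorem isLeast_regularSystem {F : Type*} [Field F] {f : Fin n → PowerSeries F} (hn : n ≠ 0)
    (hf : ∀ r : ℕ, 1 ≤ r → IsNormal f (fun _ => r)) (q : ℝ≥0) (i : Fin n) :
    IsLeast (admissible (fun i => evalInvT (f i)) q (i.val + 1)) (regularSystem n q i) := by
  obtain ⟨r, h₁, h₂⟩ := exists_block hn q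
  rw [regularSystem_eq hn h₁ h₂.le]
  set c : ℕ := i.rev.val with hc
  have hci : i.val + 1 + c = n := by rw [hc, Fin.val_rev]; omega
  have hciR : (i.val : ℝ) + 1 + c = n := by exact_mod_cast hci
  set τ : ℝ := max 0 (min 1 ((q : ℝ) - n * r - c)) with hτ
  have hτ0 : 0 ≤ τ := le_max_left _ _
  have lower (ρ k : ℕ) (t : ℝ) (hk : i.val + 1 + k ≤ n) (ht : (ρ : ℝ) ≤ t)
      (hqt : (q : ℝ) - t ≤ n * ρ - ρ + k) :
      i.val + 1 ≤ Module.finrank (RatFunc F)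
        (spanK (solutions (fun i => evalInvT (f i)) q t)) := by
    -- This `N` makes the threshold `N - (ρ + 1) + 1` equal to `n ρ - ρ + k` and leaves `n - k ≥ i +
    -- 1` dimensions.
    obtain ⟨x, hx, hmem⟩ := exists_linearIndependent_boundedSolutions f (d := ρ + 1)
      (N := n * ρ + k) (p := i.val + 1) (by rw [mul_add, mul_one]; omega)
    have h0 := card_le_finrank_spanK
      (linearIndependent_poly_of_boundedSolutions hf ρ hx fun l =>
        ⟨(hmem l).1, fun j hj => (hmem l).2 j (by push_cast; linarith)⟩)
      (fun l => boundedSolutions_subset_solutions (q := q) (t := t) (by push_cast; linarith)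
        (by push_cast; linarith) (hmem l))
    simpa using h0
  constructor
  · refine ⟨by positivity, ?_⟩
    -- Until coordinate `i` has finished rising, degree at most `r` suffices; afterwards `t = r + 1`
    -- allows one more degree, and no extra vanishing is needed.
    rcases le_or_gt ((q : ℝ) - n * r - c) 1 with h | h
    · refine lower r c _ hci.le (by linarith) ?_
      rw [min_eq_right h] at hτ
      linarith [le_max_right 0 ((q : ℝ) - n * r - c)]
    · rw [min_eq_left h.le, max_eq_right zero_le_one] at hτ
      refine lower (r + 1) 0 _ (by omega) (by push_cast; linarith) ?_
      push_cast
      linarith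
  · rintro t ⟨ht0, ht⟩
    by_contra! hlt
    rcases lt_or_ge t r with htr | htr
    · have hsub : solutions (fun i => evalInvT (f i)) q t ⊆
          (boundedSolutions (fun i => evalInvT (f i)) r (n * r - r + 1) :
            Set (Fin n → F[X])) :=
        solutions_subset_boundedSolutions htr (by push_cast; linarith)
      have h3 := ht.trans (finrank_spanK_mono hsub)
      rw [IsNormal.boundedSolutions_eq_bot hf] at h3
      have h4 := h3.trans (finrank_spanK_le _)
      simp at h4
    -- Here `r ≤ t < r + τ` forces `τ > 0`, so the clamp at `0` is inactive; then `q - t > n r - r +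
    -- c` and at most `n - (c + 1) = i` dimensions are left.
    · have hτ1 : τ ≤ 1 := max_le zero_le_one (min_le_left _ _)
      have hτc : τ ≤ q - n * r - c := by
        rcases le_or_gt (min 1 ((q : ℝ) - n * r - c)) 0 with h | h
        · rw [max_eq_left h] at hτ
          linarith
        · rw [max_eq_right h.le] at hτ
          exact hτ.le.trans (min_le_right _ _)
      have hsub : solutions (fun i => evalInvT (f i)) q t ⊆
          (boundedSolutions (fun i => evalInvT (f i)) (r + 1) (n * r - r + (c + 1 : ℕ)) :
            Set (Fin n → F[X])) :=
        solutions_subset_boundedSolutions (by push_cast; linarith) (by push_cast; linarith)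
      obtain ⟨hfin, hle⟩ := finrank_boundedSolutions_le hf r (k := c + 1) (by omega)
      have h3 := (ht.trans (finrank_spanK_mono hsub)).trans ((finrank_spanK_le _).trans hle)
      omega

theorem mapL_eq_regularSystem {F : Type*} [Field F] {f : Fin n → PowerSeries F} (hn : n ≠ 0)
    (hf : ∀ r : ℕ, 1 ≤ r → IsNormal f (fun _ => r)) :
    mapL (fun i => evalInvT (f i)) = regularSystem n := by
  funext q i
  exact (isLeast_regularSystem hn hf q i).csInf_eq

/-- The index of the coordinate of `regularSystem n` that grows on `[m, m + 1]`. -/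
def growingIndex (hn : n ≠ 0) (m : ℕ) : Fin n :=
  Fin.rev ⟨m % n, Nat.mod_lt _ (Nat.pos_of_ne_zero hn)⟩

theorem regularSystem_natCast (hn : n ≠ 0) (m : ℕ) (i : Fin n) :
    regularSystem n m i = ((m / n : ℕ) : ℝ) + if (i.rev : ℕ) < m % n then 1 else 0 := by
  have hm : (n : ℝ) * (m / n : ℕ) + (m % n : ℕ) = m := by exact_mod_cast Nat.div_add_mod m n
  have hlt : ((m % n : ℕ) : ℝ) ≤ n := by exact_mod_cast (Nat.mod_lt _ (Nat.pos_of_ne_zero hn)).le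
  have h0 : (0 : ℝ) ≤ (m % n : ℕ) := by positivity
  rw [regularSystem_eq hn (r := m / n) (by push_cast at hm ⊢; linarith) (by
    push_cast at hm hlt ⊢; linarith)]
  have e : ((m : ℝ≥0) : ℝ) - n * (m / n : ℕ) = (m % n : ℕ) := by
    rw [NNReal.coe_natCast]; linarith
  rw [e]
  split_ifs with h
  · have : ((i.rev : ℕ) : ℝ) + 1 ≤ (m % n : ℕ) := by exact_mod_cast h
    rw [min_eq_left (by linarith), max_eq_right zero_le_one]
  · have : ((m % n : ℕ) : ℝ) ≤ ((i.rev : ℕ) : ℝ) := by exact_mod_cast not_lt.1 h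
    rw [max_eq_left ((min_le_right _ _).trans (by linarith))]

theorem regularSystem_eq_add (hn : n ≠ 0) {m : ℕ} {t : ℝ≥0} (h₁ : (m : ℝ) ≤ t)
    (h₂ : (t : ℝ) ≤ m + 1) :
    regularSystem n t = regularSystem n m +
      ((t : ℝ) - m) • (Pi.single (growingIndex hn m) (1 : ℝ) : Fin n → ℝ) := by
  funext i
  have hm : (n : ℝ) * (m / n : ℕ) + (m % n : ℕ) = m := by exact_mod_cast Nat.div_add_mod m n
  have hlt : ((m % n : ℕ) : ℝ) + 1 ≤ n := by exact_mod_cast Nat.mod_lt _ (Nat.pos_of_ne_zero hn)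
  have h0 : (0 : ℝ) ≤ (m % n : ℕ) := by positivity
  rw [regularSystem_eq hn (r := m / n) (by linarith) (by linarith), Pi.add_apply,
    regularSystem_natCast hn, Pi.smul_apply, Pi.single_apply]
  have hi : i = growingIndex hn m ↔ (i.rev : ℕ) = m % n := by
    rw [growingIndex, ← Fin.rev_eq_iff, Fin.ext_iff]
  simp only [hi, smul_eq_mul]
  rcases lt_trichotomy (i.rev : ℕ) (m % n) with h | h | h
  · have : ((i.rev : ℕ) : ℝ) + 1 ≤ (m % n : ℕ) := by exact_mod_cast h
    rw [if_pos h, if_neg h.ne, min_eq_left (by linarith), max_eq_right zero_le_one]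
    ring
  · rw [if_neg h.not_lt, if_pos h, h, min_eq_right (by linarith), max_eq_right (by linarith)]
    linarith
  · have : ((m % n : ℕ) : ℝ) + 1 ≤ ((i.rev : ℕ) : ℝ) := by exact_mod_cast h
    rw [if_neg h.not_gt, if_neg h.ne', max_eq_left ((min_le_right _ _).trans (by linarith))]
    ring

theorem regularSystem_sub (hn : n ≠ 0) {m : ℕ} {s t : ℝ≥0} (hs₁ : (m : ℝ) ≤ s)
    (hs₂ : (s : ℝ) ≤ m + 1) (ht₁ : (m : ℝ) ≤ t) (ht₂ : (t : ℝ) ≤ m + 1) :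
    regularSystem n t = regularSystem n s +
      ((t : ℝ) - s) • (Pi.single (growingIndex hn m) (1 : ℝ) : Fin n → ℝ) := by
  rw [regularSystem_eq_add hn ht₁ ht₂, regularSystem_eq_add hn hs₁ hs₂, add_assoc, ← add_smul]
  congr 2
  ring

theorem sum_regularSystem (hn : n ≠ 0) (q : ℝ≥0) : ∑ i, regularSystem n q i = q := by
  have step {m : ℕ} {t : ℝ≥0} (h₁ : (m : ℝ) ≤ t) (h₂ : (t : ℝ) ≤ m + 1) :
      ∑ i, regularSystem n t i = ∑ i, regularSystem n m i + ((t : ℝ) - m) := by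
    rw [regularSystem_eq_add hn h₁ h₂]
    simp [Finset.sum_add_distrib, ← Finset.mul_sum]
  have hnat (m : ℕ) : ∑ i, regularSystem n m i = m := by
    induction m with
    | zero =>
      refine (Finset.sum_eq_zero fun i _ => ?_).trans Nat.cast_zero.symm
      rw [regularSystem_natCast hn]
      simp
    | succ m ih =>
      rw [step (m := m) (by simp) (by simp), ih]
      simp
  rw [step (Nat.floor_le q.2) (Nat.lt_floor_add_one (q : ℝ)).le, hnat]
  ring

theorem isNSystem_regularSystem (hn : n ≠ 0) : IsNSystem (regularSystem n) where
  nonneg q i := by unfold regularSystem; positivity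
  mono q i j hij := by
    unfold regularSystem
    have : ((j.rev : ℕ) : ℝ) ≤ ((i.rev : ℕ) : ℝ) := by exact_mod_cast Fin.rev_le_rev.2 hij
    gcongr
  sum_eq := sum_regularSystem hn
  slopes q := by
    by_cases hq : ∃ m : ℕ, q = m
    · obtain ⟨m, rfl⟩ := hq
      -- For `m = 0` the truncated `m - 1` is harmless: the left condition concerns only `t = 0`.
      refine ⟨1, one_pos, growingIndex hn m, growingIndex hn (m - 1), ?_, ?_, ?_⟩
      · intro t h₁ h₂
        rcases m with _ | m
        · have : t = 0 := by simpa using h₂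
          simp [this]
        · have h₃ : (t : ℝ) ≤ ((m + 1 : ℕ) : ℝ≥0) := h₂
          push_cast at h₁ h₃
          exact regularSystem_sub hn (m := m) (by push_cast; linarith) (by push_cast; linarith)
            (by linarith) h₃
      · intro t h₁ h₂
        have h₃ : (((m : ℕ) : ℝ≥0) : ℝ) ≤ t := h₁
        exact regularSystem_sub hn (m := m) (by simp) (by simp) (by simpa using h₃)
          (by simpa using h₂)
      · intro _ hlt j _ _
        -- The growing index decreases by one at each integer, except at multiples of `n`, where all
        -- coordinates coincide.
        have h0 : m % n = 0 := by
          by_contra hne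
          have h1 : (m - 1) % n + 1 = m % n := by
            have h2 := Nat.div_add_mod m n
            have h3 := Nat.mod_lt m (Nat.pos_of_ne_zero hn)
            have h4 : m - 1 = (m % n - 1) + n * (m / n) := by omega
            rw [h4, Nat.add_mul_mod_self_left, Nat.mod_eq_of_lt (by omega)]
            omega
          rw [growingIndex, growingIndex, Fin.rev_lt_rev, Fin.mk_lt_mk] at hlt
          omega
        rw [regularSystem_natCast hn, regularSystem_natCast hn, h0]
        simp
    · push Not at hq
      set m := ⌊(q : ℝ)⌋₊ with hm
      have h₁ : (m : ℝ) < q := (Nat.floor_le q.2).lt_of_ne fun h => hq m (NNReal.eq (by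
        rw [NNReal.coe_natCast]; exact h.symm))
      have h₂ : (q : ℝ) < m + 1 := Nat.lt_floor_add_one _
      refine ⟨min (q - m) (m + 1 - q), lt_min (by linarith) (by linarith), growingIndex hn m,
        growingIndex hn m, ?_, ?_, fun _ h => absurd h (lt_irrefl _)⟩
      · intro t ht₁ ht₂
        have ht₃ : (t : ℝ) ≤ q := ht₂
        have := min_le_left ((q : ℝ) - m) (m + 1 - q)
        exact regularSystem_sub hn h₁.le h₂.le (by linarith) (by linarith)
      · intro t ht₁ ht₂
        have ht₃ : (q : ℝ) ≤ t := ht₁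
        have := min_le_right ((q : ℝ) - m) (m + 1 - q)
        exact regularSystem_sub hn h₁.le h₂.le (by linarith) (by linarith)

theorem mapsNatToNat_regularSystem (hn : n ≠ 0) : MapsNatToNat (regularSystem n) := by
  intro m i
  refine ⟨m / n + if (i.rev : ℕ) < m % n then 1 else 0, ?_⟩
  rw [regularSystem_natCast hn]
  push_cast
  rfl

theorem isExtremal_regularSystem (hn : 2 ≤ n) : IsExtremal hn (regularSystem n) := by
  have hn0 : n ≠ 0 := by omega
  have hn' : (0 : ℝ) < n := by positivity
  intro m
  have hlt := Nat.mod_lt m (Nat.pos_of_ne_zero hn0)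
  have hm : (n : ℝ) * (m / n : ℕ) + (m % n : ℕ) = m := by exact_mod_cast Nat.div_add_mod m n
  have hlt' : ((m % n : ℕ) : ℝ) < n := by exact_mod_cast hlt
  have h0 : (0 : ℝ) ≤ (m % n : ℕ) := by positivity
  rw [regularSystem_natCast hn0, regularSystem_natCast hn0]
  constructor
  · rw [if_neg (by rw [Fin.val_rev]; simp; omega), add_zero]
    have : ⌊(m : ℝ) / n⌋ = ((m / n : ℕ) : ℤ) := by
      rw [Int.floor_eq_iff, le_div_iff₀ hn', div_lt_iff₀ hn']
      constructor <;> rw [Int.cast_natCast] <;> linarith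
    rw [this, Int.cast_natCast]
  · have : ⌈(m : ℝ) / n⌉ = ((m / n : ℕ) : ℤ) + if 0 < m % n then 1 else 0 := by
      rw [Int.ceil_eq_iff, lt_div_iff₀ hn', div_le_iff₀ hn']
      split_ifs with h
      · have : (0 : ℝ) < (m % n : ℕ) := by exact_mod_cast h
        constructor <;> simp only [Int.cast_add, Int.cast_natCast, Int.cast_one] <;>
          linarith
      · have : ((m % n : ℕ) : ℝ) = 0 := by exact_mod_cast Nat.eq_zero_of_not_pos h
        constructor <;> simp only [Int.cast_add, Int.cast_natCast, Int.cast_zero] <;>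
          linarith
    have hrev : ((Fin.rev ⟨n - 1, by omega⟩ : Fin n) : ℕ) = 0 := by rw [Fin.val_rev]; simp; omega
    rw [this, hrev]
    push_cast
    rfl

end RegularSystem

/-! ### Uniqueness of the extremal system -/

section Uniqueness

variable {n : ℕ} {P Q : ℝ≥0 → Fin n → ℝ}

theorem IsNSystem.continuous_apply (hP : IsNSystem P) (i : Fin n) :
    Continuous fun q => P q i := by
  rw [continuous_iff_continuousAt]
  intro q
  obtain ⟨ε, hε, k, l, hl, hk, -⟩ := hP.slopes q
  rw [Metric.continuousAt_iff]
  intro δ hδ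
  refine ⟨min ε δ, lt_min hε hδ, fun t ht => ?_⟩
  obtain ⟨hte, htd⟩ := lt_min_iff.1 ht
  rw [NNReal.dist_eq] at hte htd
  have hb (j : Fin n) : |((t : ℝ) - q) * (Pi.single j (1 : ℝ) : Fin n → ℝ) i| < δ := by
    rw [Pi.single_apply]
    split_ifs
    · rwa [mul_one]
    · simpa using hδ
  rw [Real.dist_eq]
  rcases le_total t q with h | h
  · rw [hl t (by linarith [(abs_lt.1 hte).1]) h]
    simpa using hb l
  · rw [hk t h (by linarith [(abs_lt.1 hte).2])]
    simpa using hb k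

/-- The slopes `0` and `1` are given only locally; continuity makes the set `P a i ≤ P t i` closed,
so the inequality propagates to the right along `[a, b]`. -/
theorem IsNSystem.monotone_apply (hP : IsNSystem P) (i : Fin n) : Monotone fun q => P q i := by
  intro a b hab
  have hclosed : IsClosed ({t | P a i ≤ P t i} ∩ Set.Icc a b) :=
    (isClosed_le continuous_const (hP.continuous_apply i)).inter isClosed_Icc
  refine hclosed.Icc_subset_of_forall_mem_nhdsWithin (le_refl (P a i)) ?_ ⟨hab, le_rfl⟩
  rintro q ⟨hq, -⟩
  obtain ⟨ε, hε, k, l, -, hk, -⟩ := hP.slopes q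
  have hlt : q < q + ⟨ε, hε.le⟩ := lt_add_of_pos_right q hε
  filter_upwards [Ioc_mem_nhdsGT hlt] with t ht
  have ht₂ : (t : ℝ) ≤ q + ε := ht.2
  have ht₁ : (q : ℝ) ≤ t := ht.1.le
  change P a i ≤ P t i
  refine le_trans hq ?_
  rw [hk t ht.1.le ht₂, Pi.add_apply, Pi.smul_apply, Pi.single_apply, smul_eq_mul]
  split_ifs <;> linarith

/-- Each coordinate is `⌊m/n⌋` or `⌊m/n⌋ + 1`. If `R` exceeds `S` at `i`, then `S` takes the lower
value up to `i` and `R` the upper one from `i` on, so `S ≤ R` throughout, and the equal sums are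
contradicted. -/
theorem IsNSystem.natCast_eq (hn : 2 ≤ n) (hP : IsNSystem P) (hPN : MapsNatToNat P)
    (hPE : IsExtremal hn P) (hQ : IsNSystem Q) (hQN : MapsNatToNat Q) (hQE : IsExtremal hn Q)
    (m : ℕ) : P m = Q m := by
  have two {R : ℝ≥0 → Fin n → ℝ} (hR : IsNSystem R) (hRN : MapsNatToNat R)
      (hRE : IsExtremal hn R) (i : Fin n) :
      R m i = ⌊(m : ℝ) / n⌋ ∨ R m i = ⌊(m : ℝ) / n⌋ + 1 := by
    have h₁ : R m ⟨0, by omega⟩ ≤ R m i := hR.mono m (Fin.mk_le_of_le_val (Nat.zero_le _))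
    have h₂ : R m i ≤ R m ⟨n - 1, by omega⟩ := hR.mono m (Fin.le_def.2 (by simp; omega))
    rw [(hRE m).1] at h₁
    rw [(hRE m).2] at h₂
    obtain ⟨a, ha⟩ := hRN m i
    rw [ha] at h₁ h₂ ⊢
    have h₃ := Int.ceil_le_floor_add_one ((m : ℝ) / n)
    have h₁' : ⌊(m : ℝ) / n⌋ ≤ (a : ℤ) := by exact_mod_cast h₁
    have h₂' : (a : ℤ) ≤ ⌈(m : ℝ) / n⌉ := by exact_mod_cast h₂
    rcases h₁'.eq_or_lt with h | h
    · left; rw [h]; simp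
    · right
      have : (a : ℤ) = ⌊(m : ℝ) / n⌋ + 1 := by omega
      exact_mod_cast this
  have le {R S : ℝ≥0 → Fin n → ℝ} (hR : IsNSystem R) (hRN : MapsNatToNat R)
      (hRE : IsExtremal hn R) (hS : IsNSystem S) (hSN : MapsNatToNat S)
      (hSE : IsExtremal hn S) (i : Fin n) : R m i ≤ S m i := by
    by_contra! hlt
    have hR1 : R m i = ⌊(m : ℝ) / n⌋ + 1 := by
      rcases two hR hRN hRE i with h | h <;> rcases two hS hSN hSE i with h' | h' <;> linarith
    have hS0 : S m i = ⌊(m : ℝ) / n⌋ := by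
      rcases two hS hSN hSE i with h' | h' <;> linarith
    refine (Finset.sum_lt_sum (s := Finset.univ) (f := S m) (g := R m) (fun j _ => ?_)
      ⟨i, Finset.mem_univ i, hlt⟩).ne ((hS.sum_eq m).trans (hR.sum_eq m).symm)
    rcases le_total j i with h | h
    · have := hS.mono m h
      rcases two hR hRN hRE j with h' | h' <;> linarith
    · have := hR.mono m h
      rcases two hS hSN hSE j with h' | h' <;> linarith
  funext i
  exact le_antisymm (le hP hPN hPE hQ hQN hQE i) (le hQ hQN hQE hP hPN hPE i)

theorem IsNSystem.eq_regularSystem (hn : 2 ≤ n) (hP : IsNSystem P) (hPN : MapsNatToNat P)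
    (hPE : IsExtremal hn P) : P = regularSystem n := by
  have hn0 : n ≠ 0 := by omega
  have hE := isNSystem_regularSystem hn0
  have hnat := hP.natCast_eq hn hPN hPE hE (mapsNatToNat_regularSystem hn0)
    (isExtremal_regularSystem hn)
  funext q
  set m := ⌊(q : ℝ)⌋₊ with hm
  have h₁ : (m : ℝ) ≤ q := Nat.floor_le q.2
  have h₂ : (q : ℝ) ≤ m + 1 := (Nat.lt_floor_add_one (q : ℝ)).le
  have h₁' : (m : ℝ≥0) ≤ q := by rw [← NNReal.coe_le_coe]; simpa using h₁
  have h₂' : q ≤ ((m + 1 : ℕ) : ℝ≥0) := by rw [← NNReal.coe_le_coe]; simpa using h₂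
  -- Such a coordinate has equal values at `m` and `m + 1`, so monotonicity makes it constant in
  -- between.
  have hne (i : Fin n) (hi : i ≠ growingIndex hn0 m) : P q i = regularSystem n q i := by
    have e (t : ℝ≥0) (ht₁ : (m : ℝ) ≤ t) (ht₂ : (t : ℝ) ≤ m + 1) :
        regularSystem n t i = regularSystem n m i := by
      rw [regularSystem_eq_add hn0 ht₁ ht₂]
      simp [hi]
    have l₁ := hP.monotone_apply i h₁'
    have l₂ := hP.monotone_apply i h₂'
    simp only [hnat] at l₁ l₂
    rw [e _ (by simp) (by simp)] at l₂
    rw [e q h₁ h₂]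
    exact le_antisymm l₂ l₁
  funext i
  by_cases hi : i = growingIndex hn0 m
  · have hs := (hP.sum_eq q).trans (hE.sum_eq q).symm
    rw [← Finset.add_sum_erase _ _ (Finset.mem_univ i),
      ← Finset.add_sum_erase _ (regularSystem n q) (Finset.mem_univ i),
      Finset.sum_congr rfl fun j hj => hne j (hi ▸ Finset.ne_of_mem_erase hj)] at hs
    exact add_right_cancel hs
  · exact hne i hi

end Uniqueness

end ParamGeom

theorem mainTheorem2 {F : Type*} [Field F] (n : ℕ) (hn : 2 ≤ n)
    (f : Fin n → PowerSeries F)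
    (hf : ∀ r : ℕ, 1 ≤ r → ParamGeom.IsNormal f (fun _ => r)) :
    ParamGeom.normInf (fun i => ParamGeom.evalInvT (f i)) = 1 ∧
    (ParamGeom.IsNSystem (ParamGeom.mapL fun i => ParamGeom.evalInvT (f i)) ∧
      ParamGeom.MapsNatToNat (ParamGeom.mapL fun i => ParamGeom.evalInvT (f i)) ∧
      ParamGeom.IsExtremal hn (ParamGeom.mapL fun i => ParamGeom.evalInvT (f i))) ∧
    ∀ P : NNReal → Fin n → ℝ,
      ParamGeom.IsNSystem P → ParamGeom.MapsNatToNat P → ParamGeom.IsExtremal hn P →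
        P = ParamGeom.mapL fun i => ParamGeom.evalInvT (f i) := by
  have hn0 : n ≠ 0 := by omega
  rw [ParamGeom.mapL_eq_regularSystem hn0 hf]
  exact ⟨ParamGeom.normInf_evalInvT_eq_one hn0 hf,
    ⟨ParamGeom.isNSystem_regularSystem hn0, ParamGeom.mapsNatToNat_regularSystem hn0,
      ParamGeom.isExtremal_regularSystem hn⟩,
    fun P hP hPN hPE => hP.eq_regularSystem hn hPN hPE⟩
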